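/- Let $N$ be a smooth ($C^\infty$, Hausdorff, finite-dimensional, boundaryless) manifold, $K\subseteq N$ a compact subset, and $X_1,\dots,X_d$ smooth vector fields on $N$ with $\operatorname{supp}X_i\subseteq K$ and $[X_i,X_j]=0$ for all $i,j$. Their flows $\phi^{X_i}_t$ are then complete and define an action $\alpha$ of $\mathbb{R}^d$ on the $C^*$-algebra $C^0_b(N)$ of bounded continuous complex-valued functions (with the supremum norm and complex conjugation as involution) by $$\alpha_v(f)=f\circ\phi^{X_1}_{v_1}\circ\cdots\circ\phi^{X_d}_{v_d}.$$ Let $C^0_b(N)^\infty$ be the space of smooth vectors of $\alpha$, i.e. of those $f\in C^0_b(N)$ for which $v\mapsto\alpha_v(f)$ is a $C^\infty$ map $\mathbb{R}^d\to C^0_b(N)$. Let $\Theta$ be a linear operator on $\mathbb{R}^d$ that is skew-symmetric for the standard inner product, and let $\star$ be the deformed product on $C^0_b(N)^\infty$, $$f\star g=\iint \alpha_{\Theta u}(f)\,\alpha_v(g)\,e^{2\pi i\,u\cdot v}\,du\,dv .$$ Here $\iint F(u,v)e^{2\pi i u\cdot v}\,du\,dv$ is the oscillatory integral $\sum_{w}\iint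 F(u,v)\,\varphi_w(u,v)\,e^{2\pi i u\cdot v}\,du\,dv$ (an unconditionally convergent sum in $C^0_b(N)$), where $\varphi_w=\varphi_0(\cdot-w)$, $w\in\mathbb{Z}^d\times\mathbb{Z}^d$, is a partition of unity of $\mathbb{R}^d\times\mathbb{R}^d$ by the lattice translates of a nonnegative smooth compactly supported function $\varphi_0$; the value is required to be the same for all choices of $\varphi_0$. If $f\in C^0_b(N)^\infty$ satisfies $\operatorname{supp}f\cap K=\emptyset$, then for every $g\in C^0_b(N)^\infty$ the oscillatory integrals defining $f\star g$ and $g\star f$ converge and $$f\star g=fg=g\star f .$$ In particular, $\operatorname{supp}(f\star g)\cap K=\emptyset=\operatorname{supp}(g\star f)\cap K$. Hence the functions $f\in C^0_b(N)^\infty$ with $\operatorname{supp}f\cap K=\emptyset$ form a central $*$-ideal of $(C^0_b(N)^\infty,\star)$: a complex linear subspace of $C^0_b(N)^\infty$ that is closed under complex conjugation and under $\star$-multiplication from the left and from the right by elements of $C^0_b(N)^\infty$, and whose elements $\star$-commute with all elements of $C^0_b(N)^\infty$. -/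

import Mathlib

open Set Filter Topology Manifold MeasureTheory
open scoped ContDiff BoundedContinuousFunction

noncomputable section

namespace RieffelDeformation

/-! ## Flows of compactly supported vector fields on a manifold -/

section Flow

variable {n : ℕ} {N : Type*} [TopologicalSpace N] [ChartedSpace (EuclideanSpace ℝ (Fin n)) N]
  [IsManifold (𝓡 n) ∞ N]

/-- Smoothness of a vector field, as a section of the tangent bundle. -/
def SmoothField (X : (q : N) → TangentSpace (𝓡 n) q) : Prop :=
  ContMDiff (𝓡 n) (𝓡 n).tangent ∞ (fun q => (⟨q, X q⟩ : TangentBundle (𝓡 n) N))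

/-- The support of a vector field: the closure of the set of points where it does not vanish. -/
def fieldSupport (X : (q : N) → TangentSpace (𝓡 n) q) : Set N :=
  closure {q | X q ≠ 0}

/-- A `C¹` vector field has a local flow which is continuous in the initial point. -/
theorem exists_localFlow {X : (q : N) → TangentSpace (𝓡 n) q}
    (hX : ContMDiff (𝓡 n) (𝓡 n).tangent 1 (fun q => (⟨q, X q⟩ : TangentBundle (𝓡 n) N)))
    (x₀ : N) :
    ∃ ε > (0 : ℝ), ∃ U ∈ 𝓝 x₀, ∃ β : N → ℝ → N,
      (∀ x ∈ U, β x 0 = x ∧ IsMIntegralCurveOn (β x) X (Ioo (-ε) ε)) ∧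
      ∀ t ∈ Ioo (-ε) ε, ContinuousOn (fun x => β x t) U := by
  have hv := hX.contMDiffAt (x := x₀)
  rw [contMDiffAt_iff] at hv
  obtain ⟨_, hv⟩ := hv
  have hint : (𝓡 n).IsInteriorPoint x₀ := BoundarylessManifold.isInteriorPoint
  obtain ⟨ε₀, hε₀, a, r, L, K, hr, hpl⟩ := IsPicardLindelof.of_contDiffAt_one
    (hv.contDiffAt (range_mem_nhds_isInteriorPoint hint)).snd
  obtain ⟨α, hα1, hα2⟩ := (hpl 0).exists_forall_mem_closedBall_eq_hasDerivWithinAt_continuousOn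
  simp only [zero_sub, zero_add] at hα1 hα2
  set y₀ := extChartAt (𝓡 n) x₀ x₀ with hy₀
  have hopen : IsOpen (extChartAt (𝓡 n) x₀).target := isOpen_extChartAt_target x₀
  have hα0 : α (y₀, 0) = y₀ := (hα1 y₀ (Metric.mem_closedBall_self r.2)).1
  have hat : ContinuousAt α (y₀, 0) := hα2.continuousAt
    (prod_mem_nhds (Metric.closedBall_mem_nhds _ hr)
      (Icc_mem_nhds (neg_lt_zero.2 hε₀) hε₀))
  have hpre : α ⁻¹' (extChartAt (𝓡 n) x₀).target ∈ 𝓝 (y₀, (0 : ℝ)) := by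
    apply hat
    rw [hα0]
    exact hopen.mem_nhds (mem_extChartAt_target x₀)
  obtain ⟨W, hW, S, hS, hWS⟩ := mem_nhds_prod_iff.1 hpre
  obtain ⟨δ, hδ, hδS⟩ := Metric.mem_nhds_iff.1 hS
  rw [Real.ball_eq_Ioo, zero_sub, zero_add] at hδS
  set ε := min δ ε₀ with hε
  have hεpos : 0 < ε := lt_min hδ hε₀
  have hεδ : ε ≤ δ := min_le_left _ _
  have hεε₀ : ε ≤ ε₀ := min_le_right _ _
  refine ⟨ε, hεpos, (extChartAt (𝓡 n) x₀).source ∩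
      extChartAt (𝓡 n) x₀ ⁻¹' (W ∩ Metric.closedBall y₀ r),
    inter_mem (extChartAt_source_mem_nhds x₀) ((continuousAt_extChartAt x₀).preimage_mem_nhds
      (inter_mem hW (Metric.closedBall_mem_nhds _ hr))),
    fun x t => (extChartAt (𝓡 n) x₀).symm (α (extChartAt (𝓡 n) x₀ x, t)), ?_, ?_⟩
  · rintro x ⟨hxs, hxW, hxB⟩
    obtain ⟨h0, hd⟩ := hα1 _ hxB
    refine ⟨by simp only [h0]; exact PartialEquiv.left_inv _ hxs, fun t ht => ?_⟩
    set f : ℝ → EuclideanSpace ℝ (Fin n) := fun t => α (extChartAt (𝓡 n) x₀ x, t) with hf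
    let xₜ : N := (extChartAt (𝓡 n) x₀).symm (f t)
    have htδ : t ∈ Ioo (-δ) δ := ⟨by linarith [ht.1], by linarith [ht.2]⟩
    have hf3' : f t ∈ (extChartAt (𝓡 n) x₀).target :=
      hWS (mk_mem_prod hxW (hδS htδ))
    have h : HasDerivAt f (x := t) <|
        fderivWithin ℝ (extChartAt (𝓡 n) x₀ ∘ (extChartAt (𝓡 n) xₜ).symm)
          (range (𝓡 n)) (extChartAt (𝓡 n) xₜ xₜ) (X xₜ) :=
      (hd t ⟨by linarith [ht.1], by linarith [ht.2]⟩).hasDerivAt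
        (Icc_mem_nhds (by linarith [ht.1]) (by linarith [ht.2]))
    rw [← tangentCoordChange_def] at h
    have hft1 := mem_preimage.mp <|
      mem_of_mem_of_subset hf3' (extChartAt (𝓡 n) x₀).target_subset_preimage_source
    have hft2 := mem_extChartAt_source (I := 𝓡 n) xₜ
    let w : EuclideanSpace ℝ (Fin n) := X xₜ
    have hw : tangentCoordChange (𝓡 n) x₀ xₜ xₜ (tangentCoordChange (𝓡 n) xₜ x₀ xₜ w) = w := by
      rw [tangentCoordChange_comp ⟨⟨hft2, hft1⟩, hft2⟩, tangentCoordChange_self hft2]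
    have hchange : HasFDerivAt (extChartAt (𝓡 n) xₜ ∘ (extChartAt (𝓡 n) x₀).symm)
        (tangentCoordChange (𝓡 n) x₀ xₜ xₜ) (f t) := by
      apply HasFDerivWithinAt.hasFDerivAt (s := range (𝓡 n)) _ <|
        Filter.mem_of_superset (hopen.mem_nhds hf3') (extChartAt_target_subset_range ..)
      rw [← (extChartAt (𝓡 n) x₀).right_inv hf3']
      exact hasFDerivWithinAt_tangentCoordChange ⟨hft1, hft2⟩
    have hder : HasDerivAt ((extChartAt (𝓡 n) xₜ ∘ (extChartAt (𝓡 n) x₀).symm) ∘ f) w t := by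
      have h3 := hchange.comp_hasDerivAt t h
      exact hw ▸ h3
    apply HasMFDerivAt.hasMFDerivWithinAt
    refine ⟨(continuousAt_extChartAt_symm'' hf3').comp h.continuousAt, ?_⟩
    have h2 := hder.hasFDerivAt
    rw [← hasFDerivWithinAt_univ] at h2
    simp only [mfld_simps]
    exact h2
  · intro t ht
    have htδ : t ∈ Ioo (-δ) δ := ⟨by linarith [ht.1], by linarith [ht.2]⟩
    refine (continuousOn_extChartAt_symm x₀).comp (t := (extChartAt (𝓡 n) x₀).target) ?_ ?_
    · refine hα2.comp (((continuousOn_extChartAt x₀).mono inter_subset_left).prodMk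
        continuousOn_const) fun x hx => ⟨hx.2.2, by linarith [ht.1], by linarith [ht.2]⟩
    · exact fun x hx => hWS (mk_mem_prod hx.2.1 (hδS htδ))

/-- Local flows of a `C¹` vector field supported in a compact set exist for a uniform time. -/
theorem exists_localFlow_uniform {X : (q : N) → TangentSpace (𝓡 n) q}
    (hX : ContMDiff (𝓡 n) (𝓡 n).tangent 1 (fun q => (⟨q, X q⟩ : TangentBundle (𝓡 n) N)))
    {K : Set N} (hK : IsCompact K) (hXK : fieldSupport X ⊆ K) :
    ∃ ε > (0 : ℝ), ∀ x₀ : N, ∃ U ∈ 𝓝 x₀, ∃ β : N → ℝ → N,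
      (∀ x ∈ U, β x 0 = x ∧ IsMIntegralCurveOn (β x) X (Ioo (-ε) ε)) ∧
      ∀ t ∈ Ioo (-ε) ε, ContinuousOn (fun x => β x t) U := by
  have hcov : ∃ ε > (0 : ℝ), ∀ x₀ ∈ K, ∃ U ∈ 𝓝 x₀, ∃ β : N → ℝ → N,
      (∀ x ∈ U, β x 0 = x ∧ IsMIntegralCurveOn (β x) X (Ioo (-ε) ε)) ∧
      ∀ t ∈ Ioo (-ε) ε, ContinuousOn (fun x => β x t) U := by
    refine hK.induction_on (p := fun S => ∃ ε > (0 : ℝ), ∀ x₀ ∈ S, ∃ U ∈ 𝓝 x₀, ∃ β : N → ℝ → N,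
      (∀ x ∈ U, β x 0 = x ∧ IsMIntegralCurveOn (β x) X (Ioo (-ε) ε)) ∧
      ∀ t ∈ Ioo (-ε) ε, ContinuousOn (fun x => β x t) U) ?_ ?_ ?_ ?_
    · exact ⟨1, one_pos, fun _ h => h.elim⟩
    · rintro s t hst ⟨ε, hε, h⟩
      exact ⟨ε, hε, fun x hx => h x (hst hx)⟩
    · rintro s t ⟨ε, hε, h⟩ ⟨ε', hε', h'⟩
      refine ⟨min ε ε', lt_min hε hε', fun x hx => ?_⟩
      rcases hx with hx | hx
      · obtain ⟨U, hU, β, h1, h2⟩ := h x hx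
        have hsub : Ioo (-min ε ε') (min ε ε') ⊆ Ioo (-ε) ε :=
          Ioo_subset_Ioo (neg_le_neg (min_le_left _ _)) (min_le_left _ _)
        exact ⟨U, hU, β, fun y hy => ⟨(h1 y hy).1, (h1 y hy).2.mono hsub⟩,
          fun t ht => h2 t (hsub ht)⟩
      · obtain ⟨U, hU, β, h1, h2⟩ := h' x hx
        have hsub : Ioo (-min ε ε') (min ε ε') ⊆ Ioo (-ε') ε' :=
          Ioo_subset_Ioo (neg_le_neg (min_le_right _ _)) (min_le_right _ _)
        exact ⟨U, hU, β, fun y hy => ⟨(h1 y hy).1, (h1 y hy).2.mono hsub⟩,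
          fun t ht => h2 t (hsub ht)⟩
    · intro x _
      obtain ⟨ε, hε, U, hU, β, h1, h2⟩ := exists_localFlow hX x
      obtain ⟨V, hVU, hV, hxV⟩ := mem_nhds_iff.1 hU
      exact ⟨V, mem_nhdsWithin_of_mem_nhds (hV.mem_nhds hxV), ε, hε, fun y hy =>
        ⟨U, mem_of_superset (hV.mem_nhds hy) hVU, β, h1, h2⟩⟩
  obtain ⟨ε, hε, h⟩ := hcov
  refine ⟨ε, hε, fun x₀ => ?_⟩
  by_cases hx : x₀ ∈ K
  · exact h x₀ hx
  · refine ⟨(fieldSupport X)ᶜ, isClosed_closure.isOpen_compl.mem_nhds fun hc => hx (hXK hc),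
      fun x _ => x, fun x hx => ⟨rfl, fun t _ => ?_⟩, fun t _ => continuousOn_id⟩
    have h0 : X x = 0 := by
      by_contra hne
      exact hx (subset_closure hne)
    have := (hasMFDerivAt_const (I := 𝓘(ℝ, ℝ)) (I' := 𝓡 n) x t).hasMFDerivWithinAt
      (s := Ioo (-ε) ε)
    have hz : (1 : ℝ →L[ℝ] ℝ).smulRight (X x : EuclideanSpace ℝ (Fin n)) = 0 := by
      rw [show (X x : EuclideanSpace ℝ (Fin n)) = 0 from h0]
      exact ContinuousLinearMap.smulRight_zero _
    exact (congrArg (fun T : ℝ →L[ℝ] EuclideanSpace ℝ (Fin n) =>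
      HasMFDerivWithinAt 𝓘(ℝ, ℝ) (𝓡 n) (fun _ : ℝ => x) (Ioo (-ε) ε) t T) hz).mpr this

variable [T2Space N]

/-- A smooth vector field supported in a compact set has global integral curves. -/
theorem exists_integralCurve {X : (q : N) → TangentSpace (𝓡 n) q} (hX : SmoothField X)
    {K : Set N} (hK : IsCompact K) (hXK : fieldSupport X ⊆ K) (x : N) :
    ∃ γ : ℝ → N, γ 0 = x ∧ IsMIntegralCurve γ X := by
  have hX1 : ContMDiff (𝓡 n) (𝓡 n).tangent 1
      (fun q => (⟨q, X q⟩ : TangentBundle (𝓡 n) N)) := hX.of_le (by norm_num)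
  obtain ⟨ε, hε, h⟩ := exists_localFlow_uniform hX1 hK hXK
  refine exists_isMIntegralCurve_of_isMIntegralCurveOn hX1 hε (fun y => ?_) x
  obtain ⟨U, hU, β, h1, -⟩ := h y
  exact ⟨β y, h1 y (mem_of_mem_nhds hU)⟩

/-- For each time `t`, the flow `φ_t` of a smooth vector field `X` supported in a compact set:
`t ↦ φ_t(q)` is the integral curve of `X` starting at `q`. -/
def flow {X : (q : N) → TangentSpace (𝓡 n) q} (hX : SmoothField X)
    {K : Set N} (hK : IsCompact K) (hXK : fieldSupport X ⊆ K) (t : ℝ) (q : N) : N :=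
  (exists_integralCurve hX hK hXK q).choose t

section

variable {X : (q : N) → TangentSpace (𝓡 n) q} (hX : SmoothField X)
  {K : Set N} (hK : IsCompact K) (hXK : fieldSupport X ⊆ K)

theorem flow_zero (q : N) : flow hX hK hXK 0 q = q :=
  (exists_integralCurve hX hK hXK q).choose_spec.1

theorem isMIntegralCurve_flow (q : N) : IsMIntegralCurve (fun t => flow hX hK hXK t q) X :=
  (exists_integralCurve hX hK hXK q).choose_spec.2

theorem flow_add (s t : ℝ) (q : N) :
    flow hX hK hXK (s + t) q = flow hX hK hXK s (flow hX hK hXK t q) := by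
  have hX1 : ContMDiff (𝓡 n) (𝓡 n).tangent 1
      (fun q => (⟨q, X q⟩ : TangentBundle (𝓡 n) N)) := hX.of_le (by norm_num)
  have := isMIntegralCurve_Ioo_eq_of_contMDiff_boundaryless (t₀ := 0) hX1
    ((isMIntegralCurve_flow hX hK hXK q).comp_add t)
    (isMIntegralCurve_flow hX hK hXK (flow hX hK hXK t q))
    (by simp [flow_zero])
  exact congrFun this s

theorem continuous_flow (t : ℝ) : Continuous (flow hX hK hXK t) := by
  have hX1 : ContMDiff (𝓡 n) (𝓡 n).tangent 1
      (fun q => (⟨q, X q⟩ : TangentBundle (𝓡 n) N)) := hX.of_le (by norm_num)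
  obtain ⟨ε, hε, h⟩ := exists_localFlow_uniform hX1 hK hXK
  have hsmall : ∀ s ∈ Ioo (-ε) ε, Continuous (flow hX hK hXK s) := by
    intro s hs
    rw [continuous_iff_continuousAt]
    intro x
    obtain ⟨U, hU, β, h1, h2⟩ := h x
    refine ((h2 s hs).continuousAt hU).congr ?_
    filter_upwards [hU] with y hy
    exact isMIntegralCurveOn_Ioo_eqOn_of_contMDiff_boundaryless (t₀ := 0)
      ⟨neg_lt_zero.2 hε, hε⟩ hX1 (h1 y hy).2
      ((isMIntegralCurve_flow hX hK hXK y).isMIntegralCurveOn _)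
      (by rw [(h1 y hy).1, flow_zero]) hs
  obtain ⟨m, hm⟩ := exists_nat_gt (|t| / ε)
  have hm0 : (0 : ℝ) < m := lt_of_le_of_lt (by positivity) hm
  have hs : t / m ∈ Ioo (-ε) ε := by
    rw [mem_Ioo, ← abs_lt, abs_div, Nat.abs_cast, div_lt_iff₀ hm0]
    rwa [div_lt_iff₀ hε, mul_comm] at hm
  have hiter : ∀ k : ℕ, Continuous (flow hX hK hXK (k * (t / m))) := by
    intro k
    induction k with
    | zero =>
      have : flow hX hK hXK ((0 : ℕ) * (t / m)) = id := by
        funext q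
        simp [flow_zero]
      rw [this]
      exact continuous_id
    | succ k ih =>
      have : flow hX hK hXK ((k + 1 : ℕ) * (t / m)) =
          flow hX hK hXK (k * (t / m)) ∘ flow hX hK hXK (t / m) := by
        funext q
        rw [Function.comp_apply, ← flow_add]
        push_cast
        ring_nf
      rw [this]
      exact ih.comp (hsmall _ hs)
  have := hiter m
  rwa [mul_div_cancel₀ _ hm0.ne'] at this

end

end Flow

/-! ## Oscillatory integrals -/

section Oscillatory

/-- The point of the integer lattice of `ℝ^d × ℝ^d` with the given coordinates. -/
def latticePoint {d : ℕ} (w : (Fin d → ℤ) × (Fin d → ℤ)) :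
    EuclideanSpace ℝ (Fin d) × EuclideanSpace ℝ (Fin d) :=
  (WithLp.toLp 2 fun i => (w.1 i : ℝ), WithLp.toLp 2 fun i => (w.2 i : ℝ))

/-- A nonnegative smooth compactly supported function on `ℝ^d × ℝ^d` whose translates by the
integer lattice form a partition of unity. -/
structure LatticePartition (d : ℕ) where
  toFun : EuclideanSpace ℝ (Fin d) × EuclideanSpace ℝ (Fin d) → ℝ
  contDiff : ContDiff ℝ ∞ toFun
  hasCompactSupport : HasCompactSupport toFun
  nonneg : ∀ p, 0 ≤ toFun p
  hasSum_translates : ∀ p, HasSum (fun w => toFun (p - latticePoint w)) 1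

/-- One-dimensional bump whose integer translates sum to one. -/
def bump (x : ℝ) : ℝ := Real.smoothTransition (x + 1) - Real.smoothTransition x

theorem bump_eq_zero {x : ℝ} (h : x ∉ Icc (-1 : ℝ) 1) : bump x = 0 := by
  unfold bump
  rw [mem_Icc, not_and_or, not_le, not_le] at h
  rcases h with h | h
  · rw [Real.smoothTransition.zero_of_nonpos (by linarith),
      Real.smoothTransition.zero_of_nonpos (by linarith), sub_zero]
  · rw [Real.smoothTransition.one_of_one_le (by linarith),
      Real.smoothTransition.one_of_one_le (by linarith), sub_self]

theorem bump_nonneg (x : ℝ) : 0 ≤ bump x :=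
  sub_nonneg.2 (Real.smoothTransition.monotone (by linarith))

theorem bump_sub_int_eq_zero (x : ℝ) {k : ℤ} (hk : k ∉ ({⌊x⌋, ⌊x⌋ + 1} : Finset ℤ)) :
    bump (x - k) = 0 := by
  have h1 := Int.floor_le x
  have h2 := Int.lt_floor_add_one x
  simp only [Finset.mem_insert, Finset.mem_singleton, not_or] at hk
  unfold bump
  rcases lt_trichotomy k ⌊x⌋ with h | h | h
  · have : (k : ℝ) + 1 ≤ ⌊x⌋ := by exact_mod_cast h
    rw [Real.smoothTransition.one_of_one_le (by linarith),
      Real.smoothTransition.one_of_one_le (by linarith), sub_self]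
  · exact absurd h hk.1
  · have h3 : ⌊x⌋ + 1 < k := lt_of_le_of_ne h (Ne.symm hk.2)
    have : (⌊x⌋ : ℝ) + 1 + 1 ≤ k := by exact_mod_cast h3
    rw [Real.smoothTransition.zero_of_nonpos (by linarith),
      Real.smoothTransition.zero_of_nonpos (by linarith), sub_zero]

theorem sum_bump (x : ℝ) : ∑ k ∈ ({⌊x⌋, ⌊x⌋ + 1} : Finset ℤ), bump (x - k) = 1 := by
  have h1 := Int.floor_le x
  have h2 := Int.lt_floor_add_one x
  rw [Finset.sum_pair (by omega)]
  unfold bump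
  push_cast
  rw [Real.smoothTransition.one_of_one_le (x := x - ⌊x⌋ + 1) (by linarith),
    Real.smoothTransition.zero_of_nonpos (x := x - (⌊x⌋ + 1)) (by linarith)]
  ring_nf

/-- Lattice partitions of unity exist, so that quantifying over them is meaningful. -/
instance (d : ℕ) : Nonempty (LatticePartition d) := by
  refine ⟨⟨fun p => (∏ i, bump (p.1 i)) * ∏ i, bump (p.2 i), ?_, ?_, ?_, ?_⟩⟩
  · have hb : ContDiff ℝ ∞ bump :=
      (Real.smoothTransition.contDiff.comp (contDiff_id.add contDiff_const)).sub
        Real.smoothTransition.contDiff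
    refine ContDiff.mul (contDiff_prod fun i _ => hb.comp ?_)
      (contDiff_prod fun i _ => hb.comp ?_) <;> fun_prop
  · let S : Set (EuclideanSpace ℝ (Fin d)) :=
      (EuclideanSpace.equiv (Fin d) ℝ) ⁻¹' (Set.univ.pi fun _ => Icc (-1 : ℝ) 1)
    have hS : IsCompact S :=
      (EuclideanSpace.equiv (Fin d) ℝ).toHomeomorph.isCompact_preimage.2
        (isCompact_univ_pi fun _ => isCompact_Icc)
    refine HasCompactSupport.intro (hS.prod hS) fun p hp => ?_
    have hz : ∀ u : EuclideanSpace ℝ (Fin d), u ∉ S → ∏ i, bump (u i) = 0 := by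
      intro u hu
      have : ∃ i, u i ∉ Icc (-1 : ℝ) 1 := by
        by_contra! hc
        exact hu fun i _ => hc i
      obtain ⟨i, hi⟩ := this
      exact Finset.prod_eq_zero (Finset.mem_univ i) (bump_eq_zero hi)
    rw [Set.mem_prod, not_and_or] at hp
    rcases hp with hp | hp
    · simp only [hz _ hp, zero_mul]
    · simp only [hz _ hp, mul_zero]
  · exact fun p => mul_nonneg (Finset.prod_nonneg fun i _ => bump_nonneg _)
      (Finset.prod_nonneg fun i _ => bump_nonneg _)
  · intro p
    let T : EuclideanSpace ℝ (Fin d) → Finset (Fin d → ℤ) := fun u =>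
      Fintype.piFinset fun i => {⌊u i⌋, ⌊u i⌋ + 1}
    have hz : ∀ (u : EuclideanSpace ℝ (Fin d)) (k : Fin d → ℤ), k ∉ T u →
        ∏ i, bump (u i - k i) = 0 := by
      intro u k hk
      simp only [T, Fintype.mem_piFinset, not_forall] at hk
      obtain ⟨i, hi⟩ := hk
      exact Finset.prod_eq_zero (Finset.mem_univ i) (bump_sub_int_eq_zero _ hi)
    have hs : ∀ u : EuclideanSpace ℝ (Fin d), ∑ k ∈ T u, ∏ i, bump (u i - k i) = 1 := by
      intro u
      have := Finset.prod_univ_sum (fun i => ({⌊u i⌋, ⌊u i⌋ + 1} : Finset ℤ))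
        (fun i k => bump (u i - k))
      rw [← this]
      exact Finset.prod_eq_one fun i _ => sum_bump _
    have key : ∑ w ∈ T p.1 ×ˢ T p.2,
        (∏ i, bump (p.1 i - w.1 i)) * ∏ i, bump (p.2 i - w.2 i) = 1 := by
      simp only [Finset.sum_product, ← Finset.mul_sum, hs, mul_one]
    rw [← key]
    refine hasSum_sum_of_ne_finset_zero fun w hw => ?_
    rw [Finset.mem_product, not_and_or] at hw
    rcases hw with hw | hw
    · have := hz _ _ hw
      simp [latticePoint, this]
    · have := hz _ _ hw
      simp [latticePoint, this]

variable {d : ℕ} {A : Type*} [NormedAddCommGroup A] [NormedSpace ℂ A]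

/-- `HasOscillatoryIntegral F a` says that the oscillatory integral
`∬ F(u,v) e^{2πi u·v} du dv = ∑_w ∬ F(u,v) φ_w(u,v) e^{2πi u·v} du dv`
converges to `a`, for every partition of unity `(φ_w)` by lattice translates. -/
def HasOscillatoryIntegral
    (F : EuclideanSpace ℝ (Fin d) × EuclideanSpace ℝ (Fin d) → A) (a : A) : Prop :=
  ∀ φ : LatticePartition d,
    HasSum (fun w => ∫ p, ((φ.toFun (p - latticePoint w) : ℂ) *
      Complex.exp (2 * Real.pi * Complex.I * (inner ℝ p.1 p.2 : ℝ))) • F p) a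

theorem HasOscillatoryIntegral.unique
    {F : EuclideanSpace ℝ (Fin d) × EuclideanSpace ℝ (Fin d) → A} {a b : A}
    (ha : HasOscillatoryIntegral F a) (hb : HasOscillatoryIntegral F b) : a = b :=
  let φ : LatticePartition d := Classical.arbitrary _
  (ha φ).unique (hb φ)

open Classical in
/-- The value of the oscillatory integral (and `0` if it does not converge). -/
def oscillatoryIntegral
    (F : EuclideanSpace ℝ (Fin d) × EuclideanSpace ℝ (Fin d) → A) : A :=
  if h : ∃ a, HasOscillatoryIntegral F a then h.choose else 0

theorem HasOscillatoryIntegral.eq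
    {F : EuclideanSpace ℝ (Fin d) × EuclideanSpace ℝ (Fin d) → A} {a : A}
    (ha : HasOscillatoryIntegral F a) : oscillatoryIntegral F = a := by
  have h : ∃ a, HasOscillatoryIntegral F a := ⟨a, ha⟩
  rw [oscillatoryIntegral, dif_pos h]
  exact h.choose_spec.unique ha

end Oscillatory

/-! ## Commuting vector fields, the action on bounded functions, and the deformed product -/

section Deformation

variable {n : ℕ} {N : Type*} [TopologicalSpace N] [ChartedSpace (EuclideanSpace ℝ (Fin n)) N]
  [IsManifold (𝓡 n) ∞ N] [T2Space N]

/-- A family of `d` smooth, pairwise commuting vector fields with supports in the compact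
set `K`. -/
structure CommutingFields (n d : ℕ) {N : Type*} [TopologicalSpace N]
    [ChartedSpace (EuclideanSpace ℝ (Fin n)) N] [IsManifold (𝓡 n) ∞ N]
    (K : TopologicalSpace.Compacts N) where
  field : Fin d → (q : N) → TangentSpace (𝓡 n) q
  smooth : ∀ i, SmoothField (field i)
  support_subset : ∀ i, fieldSupport (field i) ⊆ K
  commute : ∀ i j q, VectorField.mlieBracket (𝓡 n) (field i) (field j) q = 0

namespace CommutingFields

variable {d : ℕ} {K : TopologicalSpace.Compacts N} (𝒳 : CommutingFields n d K)

/-- The time-`t` flow map of the `i`-th vector field. -/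
def flowMap (i : Fin d) (t : ℝ) : C(N, N) where
  toFun := flow (𝒳.smooth i) K.isCompact (𝒳.support_subset i) t
  continuous_toFun := continuous_flow (𝒳.smooth i) K.isCompact (𝒳.support_subset i) t

/-- The composition `φ^{X_1}_{v_1} ∘ ⋯ ∘ φ^{X_d}_{v_d}` of the flows. -/
def jointFlow (v : EuclideanSpace ℝ (Fin d)) : C(N, N) :=
  (List.ofFn fun i => 𝒳.flowMap i (v i)).foldr (fun φ ψ => φ.comp ψ) (ContinuousMap.id N)

/-- The action `α_v f = f ∘ φ^{X_1}_{v_1} ∘ ⋯ ∘ φ^{X_d}_{v_d}` of `ℝ^d` on `C_b(N)`. -/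
def action (v : EuclideanSpace ℝ (Fin d)) (f : N →ᵇ ℂ) : N →ᵇ ℂ :=
  f.compContinuous (𝒳.jointFlow v)

/-- The space `C_b(N)^∞` of smooth vectors: those `f` for which `v ↦ α_v f` is a smooth map from
`ℝ^d` to the Banach space `C_b(N)`. -/
def smoothVectors : Submodule ℂ (N →ᵇ ℂ) where
  carrier := {f | ContDiff ℝ ∞ fun v => 𝒳.action v f}
  zero_mem' := (contDiff_const : ContDiff ℝ ∞ fun _ : EuclideanSpace ℝ (Fin d) => (0 : N →ᵇ ℂ))
  add_mem' := by
    intro f g hf hg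
    rw [mem_ofPred] at hf hg ⊢
    exact hf.add hg
  smul_mem' := by
    intro c f hf
    rw [mem_ofPred] at hf ⊢
    exact hf.const_smul c

/-- The integrand `(u, v) ↦ α_{Θu}(f) α_v(g)` of the deformed product. -/
def productIntegrand (Θ : EuclideanSpace ℝ (Fin d) →ₗ[ℝ] EuclideanSpace ℝ (Fin d))
    (f g : N →ᵇ ℂ) (p : EuclideanSpace ℝ (Fin d) × EuclideanSpace ℝ (Fin d)) : N →ᵇ ℂ :=
  𝒳.action (Θ p.1) f * 𝒳.action p.2 g

/-- The deformed product `f ⋆ g = ∬ α_{Θu}(f) α_v(g) e^{2πi u·v} du dv`. -/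
def deformedProduct (Θ : EuclideanSpace ℝ (Fin d) →ₗ[ℝ] EuclideanSpace ℝ (Fin d))
    (f g : N →ᵇ ℂ) : N →ᵇ ℂ :=
  oscillatoryIntegral (𝒳.productIntegrand Θ f g)

end CommutingFields

/-- `I` is a central `*`-ideal of the `*`-algebra whose underlying space is the subspace `S` of `A`
and whose multiplication is `mul`: a linear subspace of `S`, closed under multiplication from both
sides by elements of `S` and under the involution, whose elements commute with those of `S`. -/
structure IsCentralStarIdeal {A : Type*} [AddCommGroup A] [Module ℂ A] [Star A]
    (S : Submodule ℂ A) (mul : A → A → A) (I : Set A) : Prop where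
  subset : I ⊆ S
  zero_mem : 0 ∈ I
  add_mem : ∀ f ∈ I, ∀ g ∈ I, f + g ∈ I
  smul_mem : ∀ (c : ℂ), ∀ f ∈ I, c • f ∈ I
  star_mem : ∀ f ∈ I, star f ∈ I
  mul_mem_left : ∀ g ∈ S, ∀ f ∈ I, mul g f ∈ I
  mul_mem_right : ∀ f ∈ I, ∀ g ∈ S, mul f g ∈ I
  central : ∀ f ∈ I, ∀ g ∈ S, mul f g = mul g f

end Deformation

end RieffelDeformation

end

/-! ## Poisson summation for compactly supported smooth functions of several variables -/

section Poisson

open scoped FourierTransform SchwartzMap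

variable {ι : Type*}

/-! Every field vanishes off `K`, so the flows fix each point there; being invertible, they also
preserve `K` (`jointFlow_eq_self_and_mem`). If the support of `f` misses `K`, then `α_v f = f`, and
`f · α_v g = f g`: on `K` the factor `f` is zero, elsewhere the flow is the identity. Both
integrands are therefore the constant `f g`.

It remains to see that the oscillatory integral of a constant is that constant, i.e. `∑_w ∬ φ_w
e^{2πi u·v} = 1` for every lattice partition (`hasSum_integral_latticePartition`). Translating the
`w`-th integral by `w = (w₁, w₂)` multiplies the phase by the character of frequency `(w₂, w₁)`,
because `w₁·w₂` is an integer. The sum thus runs over the Fourier transform of `ψ = φ e^{2πi u·v}`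
at all lattice points, and Poisson summation (`hasSum_integral_mFourier_mul`) turns it into the sum
of `ψ` over the lattice. There the phase is 1, so what is left is a sum of translates of `φ` at the
origin, which is 1.

The ideal properties then reduce to those of the pointwise product. -/

/-- The integer vector `w`, seen as a real vector. -/
def intVec (w : ι → ℤ) : ι → ℝ := fun i => (w i : ℝ)

/-- Only finitely many lattice translates of a compactly supported function meet a given
bounded set. -/
theorem finite_translates_ne_zero [Fintype ι] {ψ : (ι → ℝ) → ℂ}
    (hψ : HasCompactSupport ψ) {B : Set (ι → ℝ)} (hB : Bornology.IsBounded B) :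
    {w : ι → ℤ | ∃ x ∈ B, ψ (x + intVec w) ≠ 0}.Finite := by
  obtain ⟨R, hR⟩ := hB.exists_norm_le
  obtain ⟨S, hS⟩ := hψ.isCompact.isBounded.exists_norm_le
  classical
  refine (Set.finite_Icc (fun _ : ι => -⌈R + S⌉) (fun _ => ⌈R + S⌉)).subset ?_
  rintro w ⟨x, hx, hw⟩
  have h1 := hR x hx
  have h2 := hS _ (subset_tsupport _ hw)
  have h3 : ‖intVec w‖ ≤ R + S := by
    calc ‖intVec w‖ = ‖(x + intVec w) - x‖ := by rw [add_sub_cancel_left]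
      _ ≤ ‖x + intVec w‖ + ‖x‖ := norm_sub_le _ _
      _ ≤ R + S := by linarith
  have h4 : ∀ i, |w i| ≤ ⌈R + S⌉ := fun i => by
    have h5 : |(w i : ℝ)| ≤ R + S := (norm_le_pi_norm (intVec w) i).trans h3
    have h6 : ((|w i| : ℤ) : ℝ) ≤ ⌈R + S⌉ := by
      push_cast
      exact h5.trans (Int.le_ceil _)
    exact_mod_cast h6
  exact ⟨fun i => (abs_le.1 (h4 i)).1, fun i => (abs_le.1 (h4 i)).2⟩

/-! ### Periodization and its descent to the torus. -/

/-- The sum of the translates of `ψ` by the integer lattice. -/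
noncomputable def periodization (ψ : (ι → ℝ) → ℂ) (x : ι → ℝ) : ℂ :=
  ∑' w : ι → ℤ, ψ (x + intVec w)

theorem periodization_add (ψ : (ι → ℝ) → ℂ) (x : ι → ℝ) (k : ι → ℤ) :
    periodization ψ (x + intVec k) = periodization ψ x := by
  unfold periodization
  -- Reindexing by `w ↦ k + w` absorbs the shift.
  rw [← (Equiv.addLeft k).tsum_eq (fun w => ψ (x + intVec w))]
  refine tsum_congr fun w => congrArg ψ ?_
  funext i
  simp [intVec, add_assoc]

/-- Compact support makes the series locally finite: on a unit ball it is one fixed finite sum of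
continuous functions. -/
theorem continuous_periodization [Fintype ι] {ψ : (ι → ℝ) → ℂ}
    (hc : Continuous ψ) (hψ : HasCompactSupport ψ) : Continuous (periodization ψ) := by
  rw [continuous_iff_continuousAt]
  intro x₀
  have hfin := finite_translates_ne_zero hψ (Metric.isBounded_ball (x := x₀) (r := 1))
  have hsum : ContinuousAt (fun x => ∑ w ∈ hfin.toFinset, ψ (x + intVec w)) x₀ := by
    fun_prop
  refine hsum.congr ?_
  filter_upwards [Metric.ball_mem_nhds x₀ one_pos] with x hx
  refine (tsum_eq_sum fun w hw => ?_).symm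
  by_contra hne
  exact hw (hfin.mem_toFinset.2 ⟨x, hx, hne⟩)

/-- The projection of `ℝ^ι` onto the torus. -/
def torusMk (x : ι → ℝ) : UnitAddTorus ι := fun i => (x i : UnitAddCircle)

theorem isOpenQuotientMap_torusMk : IsOpenQuotientMap (torusMk (ι := ι)) :=
  IsOpenQuotientMap.piMap fun _ => QuotientAddGroup.isOpenQuotientMap_mk

theorem periodization_eq_of_torusMk_eq (ψ : (ι → ℝ) → ℂ) {x y : ι → ℝ}
    (h : torusMk x = torusMk y) : periodization ψ x = periodization ψ y := by
  have h1 : ∀ i, ∃ k : ℤ, y i - x i = k := fun i => by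
    obtain ⟨k, hk⟩ := (QuotientAddGroup.eq_iff_sub_mem.1 (congrFun h i).symm)
    exact ⟨k, by simpa using hk.symm⟩
  choose k hk using h1
  rw [← periodization_add ψ x k]
  congr 1
  funext i
  simp [intVec, ← hk]

/-- The periodization, as a continuous function on the torus. -/
noncomputable def torusPeriodization [Fintype ι] {ψ : (ι → ℝ) → ℂ} (hc : Continuous ψ)
    (hψ : HasCompactSupport ψ) :
    C(UnitAddTorus ι, ℂ) where
  toFun t := periodization ψ (isOpenQuotientMap_torusMk.surjective t).choose
  continuous_toFun := by
    rw [← isOpenQuotientMap_torusMk.continuous_comp_iff]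
    refine (continuous_periodization hc hψ).congr fun x => ?_
    exact (periodization_eq_of_torusMk_eq ψ
      (isOpenQuotientMap_torusMk.surjective (torusMk x)).choose_spec).symm

theorem torusPeriodization_torusMk [Fintype ι] {ψ : (ι → ℝ) → ℂ}
    (hc : Continuous ψ) (hψ : HasCompactSupport ψ) (x : ι → ℝ) :
    torusPeriodization hc hψ (torusMk x) = periodization ψ x :=
  periodization_eq_of_torusMk_eq ψ (isOpenQuotientMap_torusMk.surjective (torusMk x)).choose_spec

/-! ### Fourier coefficients by unfolding. -/

/-- Integrals over `ℝ^ι` unfold into integrals of lattice translates over the unit cube. -/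
theorem hasSum_integral_unitCube [Fintype ι] {G : (ι → ℝ) → ℂ} (hG : Integrable G) :
    HasSum (fun w : ι → ℤ => ∫ x in {x : ι → ℝ | ∀ i, x i ∈ Ioc (0 : ℝ) (0 + 1)},
      G (x + intVec w)) (∫ x, G x) := by
  let s : (ι → ℤ) → Set (ι → ℝ) := fun w => {x | ∀ i, x i ∈ Ioc (w i : ℝ) (w i + 1)}
  have hs : ∀ w, MeasurableSet (s w) := fun w => MeasurableSet.univ_pi' fun _ => measurableSet_Ioc
  have hd : Pairwise (Function.onFun Disjoint s) := by
    intro v w hvw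
    refine Set.disjoint_left.2 fun x hx hx' => hvw (funext fun i => ?_)
    have h1 := hx i
    have h2 := hx' i
    rw [mem_Ioc] at h1 h2
    have h3 : v i < w i + 1 := by exact_mod_cast h1.1.trans_le h2.2
    have h4 : w i < v i + 1 := by exact_mod_cast h2.1.trans_le h1.2
    omega
  have hu : ⋃ w, s w = univ := by
    -- The cubes are open on the left and closed on the right, so the corner containing `x` is `⌈x⌉
    -- - 1` rather than `⌊x⌋`.
    refine eq_univ_of_forall fun x => mem_iUnion.2 ⟨fun i => ⌈x i⌉ - 1, fun i => ?_⟩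
    have h1 := Int.le_ceil (x i)
    have h2 := Int.ceil_lt_add_one (x i)
    push_cast
    constructor <;> linarith
  have key := hasSum_integral_iUnion (μ := volume) hs hd hG.integrableOn
  rw [hu, setIntegral_univ] at key
  refine key.congr_fun fun w => ?_
  have hmp := (measurePreserving_add_right (volume : Measure (ι → ℝ)) (intVec w))
  rw [← hmp.setIntegral_preimage_emb (MeasurableEquiv.addRight (intVec w)).measurableEmbedding G]
  congr 2
  ext x
  simp only [s, intVec, mem_preimage, mem_ofPred_eq, Pi.add_apply, mem_Ioc]
  refine forall_congr' fun i => and_congr ?_ ?_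
  · rw [lt_add_iff_pos_left]
  · rw [zero_add, add_comm, add_le_add_iff_left]

theorem mFourier_torusMk [Fintype ι] (n : ι → ℤ) (x : ι → ℝ) :
    UnitAddTorus.mFourier n (torusMk x) =
      Complex.exp (2 * Real.pi * Complex.I * (∑ i, (n i : ℝ) * x i : ℝ)) := by
  simp only [UnitAddTorus.mFourier, torusMk, ContinuousMap.coe_mk, fourier_coe_apply]
  rw [← Complex.exp_sum]
  congr 1
  push_cast
  rw [Finset.mul_sum]
  refine Finset.sum_congr rfl fun i _ => ?_
  ring

theorem mFourier_add_intVec [Fintype ι] (n w : ι → ℤ) (x : ι → ℝ) :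
    UnitAddTorus.mFourier n (torusMk (x + intVec w)) = UnitAddTorus.mFourier n (torusMk x) := by
  congr 1
  funext i
  simp [torusMk, intVec]

/-- The Fourier coefficients of the periodization are the values of the Fourier transform. -/
theorem mFourierCoeff_torusPeriodization [Fintype ι] {ψ : (ι → ℝ) → ℂ}
    (hc : Continuous ψ) (hψ : HasCompactSupport ψ) (n : ι → ℤ) :
    UnitAddTorus.mFourierCoeff (torusPeriodization hc hψ) n =
      ∫ x, UnitAddTorus.mFourier (-n) (torusMk x) * ψ x := by
  have hmk : Continuous (torusMk (ι := ι)) := isOpenQuotientMap_torusMk.continuous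
  have hGc : Continuous fun x => UnitAddTorus.mFourier (-n) (torusMk x) * ψ x := by fun_prop
  have hG : Integrable fun x => UnitAddTorus.mFourier (-n) (torusMk x) * ψ x :=
    hGc.integrable_of_hasCompactSupport hψ.mul_left
  have hQ : Bornology.IsBounded {x : ι → ℝ | ∀ i, x i ∈ Ioc (0 : ℝ) (0 + 1)} := by
    refine (Metric.isBounded_Icc (0 : ι → ℝ) (fun _ => 0 + 1)).subset fun x hx => ?_
    exact ⟨fun i => (hx i).1.le, fun i => (hx i).2⟩
  have hQm : MeasurableSet {x : ι → ℝ | ∀ i, x i ∈ Ioc (0 : ℝ) (0 + 1)} :=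
    MeasurableSet.univ_pi' fun _ => measurableSet_Ioc
  have hfin := finite_translates_ne_zero hψ hQ
  -- Only finitely many translates of `ψ` meet the unit cube, so sum and integral may be exchanged.
  rw [UnitAddTorus.mFourierCoeff_eq_integral _ _ 0, ← (hasSum_integral_unitCube hG).tsum_eq,
    tsum_eq_sum (s := hfin.toFinset), ← integral_finsetSum]
  · refine setIntegral_congr_fun hQm fun x hx => ?_
    change UnitAddTorus.mFourier (-n) (torusMk x) • torusPeriodization hc hψ (torusMk x) = _
    simp only [torusPeriodization_torusMk, periodization, mFourier_add_intVec, smul_eq_mul,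
      ← Finset.mul_sum]
    congr 1
    refine tsum_eq_sum fun w hw => ?_
    by_contra hne
    exact hw (hfin.mem_toFinset.2 ⟨x, hx, hne⟩)
  · exact fun w _ => (hG.comp_add_right (intVec w)).integrableOn
  · intro w hw
    refine setIntegral_eq_zero_of_forall_eq_zero fun x hx => ?_
    by_contra hne
    exact hw (hfin.mem_toFinset.2 ⟨x, hx, right_ne_zero_of_mul hne⟩)

/-! ### Summability of the coefficients and the summation formula. -/

/-- A Schwartz function is summable over the integer lattice. -/
theorem summable_schwartz_intVec [Fintype ι] (f : 𝓢(EuclideanSpace ℝ ι, ℂ)) :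
    Summable fun n : ι → ℤ => f (WithLp.toLp 2 (intVec n)) := by
  let b := (EuclideanSpace.basisFun ι ℝ).toBasis
  let L : Submodule ℤ (EuclideanSpace ℝ ι) := Submodule.span ℤ (Set.range b)
  have hmem : ∀ n : ι → ℤ, WithLp.toLp 2 (intVec n) ∈ L := fun n => by
    rw [Module.Basis.mem_span_iff_repr_mem]
    intro i
    exact ⟨n i, by simp [b, intVec]⟩
  have hinj : Function.Injective fun n : ι → ℤ => (⟨WithLp.toLp 2 (intVec n), hmem n⟩ : L) := by
    intro n m h
    funext i
    have := congrFun (congrArg (WithLp.ofLp) (congrArg Subtype.val h)) i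
    simpa [intVec] using this
  -- Inverse powers of the norm are summable over a lattice once the exponent exceeds its rank; rank
  -- plus one suffices.
  have hsum := (ZLattice.summable_norm_pow_inv L (Module.finrank ℤ L + 1)
    (Nat.lt_succ_self _)).comp_injective hinj
  obtain ⟨C, hC⟩ := f.decay (Module.finrank ℤ L + 1) 0
  refine Summable.of_norm_bounded_eventually (hsum.mul_left C) ?_
  rw [Filter.eventually_cofinite]
  -- The origin must be excepted: there the inverse power of the norm takes the default value 0, so
  -- the bound may fail.
  refine (Set.finite_singleton (0 : ι → ℤ)).subset fun n hn => ?_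
  by_contra hne
  refine hn ?_
  have hpos : 0 < ‖(WithLp.toLp 2 (intVec n) : EuclideanSpace ℝ ι)‖ := by
    rw [norm_pos_iff]
    intro h0
    refine hne (funext fun i => ?_)
    simpa [intVec] using congrFun (congrArg WithLp.ofLp h0) i
  have h1 := hC.2 (WithLp.toLp 2 (intVec n))
  rw [norm_iteratedFDeriv_zero] at h1
  change _ ≤ C * ‖(WithLp.toLp 2 (intVec n) : EuclideanSpace ℝ ι)‖⁻¹ ^ _
  rw [inv_pow, ← div_eq_mul_inv, le_div_iff₀ (by positivity), mul_comm]
  exact h1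

/-- **Poisson summation** for a compactly supported smooth function of several variables. -/
theorem hasSum_integral_mFourier_mul [Fintype ι] {ψ : (ι → ℝ) → ℂ} (hs : ContDiff ℝ ∞ ψ)
    (hψ : HasCompactSupport ψ) :
    HasSum (fun n : ι → ℤ => ∫ x, UnitAddTorus.mFourier n (torusMk x) * ψ x)
      (∑' w : ι → ℤ, ψ (intVec w)) := by
  have hc := hs.continuous
  let e := (EuclideanSpace.equiv ι ℝ)
  have hs' : ContDiff ℝ ∞ (ψ ∘ e) := hs.comp e.contDiff
  have hψ' : HasCompactSupport (ψ ∘ e) := hψ.comp_homeomorph e.toHomeomorph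
  have hcoeff : ∀ n : ι → ℤ, UnitAddTorus.mFourierCoeff (torusPeriodization hc hψ) n =
      𝓕 (hψ'.toSchwartzMap hs') (WithLp.toLp 2 (intVec n)) := by
    intro n
    rw [mFourierCoeff_torusPeriodization, SchwartzMap.fourier_coe, Real.fourier_eq',
      ← (PiLp.volume_preserving_toLp ι).integral_comp
        (MeasurableEquiv.toLp 2 (ι → ℝ)).measurableEmbedding]
    refine integral_congr_ae (Eventually.of_forall fun x => ?_)
    simp only [mFourier_torusMk]
    congr 2
    simp [PiLp.inner_apply, intVec, Finset.mul_sum]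
    rw [Finset.sum_mul]
    exact Finset.sum_congr rfl fun i _ => by ring
  have hsum : Summable (UnitAddTorus.mFourierCoeff (torusPeriodization hc hψ)) :=
    (summable_schwartz_intVec (𝓕 (hψ'.toSchwartzMap hs'))).congr fun n => (hcoeff n).symm
  -- Summable coefficients make the Fourier series converge pointwise; at 0 every character is 1,
  -- leaving the sum of the coefficients.
  have key := UnitAddTorus.hasSum_mFourier_series_apply_of_summable hsum (torusMk 0)
  rw [torusPeriodization_torusMk] at key
  -- The `n`-th coefficient integrates against frequency `-n`, while the statement uses `n`.
  rw [← (Equiv.neg (ι → ℤ)).hasSum_iff] at key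
  convert key using 1
  · funext n
    have h1 : UnitAddTorus.mFourier (-n) (torusMk (0 : ι → ℝ)) = 1 := by
      simp [mFourier_torusMk]
    simp [h1, mFourierCoeff_torusPeriodization]
  · simp [periodization]

end Poisson

/-! ## Oscillatory integrals of constants -/

namespace RieffelDeformation

section ConstantIntegrand

variable {d : ℕ}

/-- The identification of `ℝ^{d+d}` with `ℝ^d × ℝ^d`. -/
noncomputable def pairEquiv (d : ℕ) : (Fin d ⊕ Fin d → ℝ) ≃L[ℝ]
    EuclideanSpace ℝ (Fin d) × EuclideanSpace ℝ (Fin d) :=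
  ((LinearEquiv.sumArrowLequivProdArrow (Fin d) (Fin d) ℝ ℝ).trans
    ((WithLp.linearEquiv 2 ℝ (Fin d → ℝ)).symm.prodCongr
      (WithLp.linearEquiv 2 ℝ (Fin d → ℝ)).symm)).toContinuousLinearEquiv

theorem pairEquiv_apply (x : Fin d ⊕ Fin d → ℝ) :
    pairEquiv d x = (WithLp.toLp 2 (x ∘ Sum.inl), WithLp.toLp 2 (x ∘ Sum.inr)) := rfl

theorem measurePreserving_pairEquiv : MeasurePreserving (pairEquiv d) := by
  have h1 := volume_measurePreserving_sumPiEquivProdPi (fun _ : Fin d ⊕ Fin d => ℝ)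
  have h2 := (PiLp.volume_preserving_toLp (Fin d)).prod (PiLp.volume_preserving_toLp (Fin d))
  exact h2.comp h1

/-- The oscillating factor `e^{2πi u·v}`. -/
noncomputable def pairCharacter
    (p : EuclideanSpace ℝ (Fin d) × EuclideanSpace ℝ (Fin d)) : ℂ :=
  Complex.exp (2 * Real.pi * Complex.I * (inner ℝ p.1 p.2 : ℝ))

theorem contDiff_pairCharacter : ContDiff ℝ ∞ (pairCharacter (d := d)) := by
  unfold pairCharacter
  have h : ContDiff ℝ ∞ fun p : EuclideanSpace ℝ (Fin d) × EuclideanSpace ℝ (Fin d) =>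
      ((inner ℝ p.1 p.2 : ℝ) : ℂ) :=
    Complex.ofRealCLM.contDiff.comp (contDiff_fst.inner ℝ contDiff_snd)
  exact (contDiff_const.mul h).cexp

/-- The inner product of two integer vectors is an integer. -/
theorem pairCharacter_latticePoint (w : (Fin d → ℤ) × (Fin d → ℤ)) :
    pairCharacter (latticePoint w) = 1 := by
  rw [pairCharacter, Complex.exp_eq_one_iff]
  refine ⟨∑ i, w.1 i * w.2 i, ?_⟩
  simp [latticePoint, PiLp.inner_apply, mul_comm]

/-- The frequency vector by which translation by `w` changes the oscillating factor. -/
def swapEquiv (d : ℕ) : (Fin d → ℤ) × (Fin d → ℤ) ≃ (Fin d ⊕ Fin d → ℤ) :=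
  (Equiv.prodComm _ _).trans (Equiv.sumArrowEquivProdArrow _ _ _).symm

theorem swapEquiv_inl (w : (Fin d → ℤ) × (Fin d → ℤ)) (i : Fin d) :
    swapEquiv d w (Sum.inl i) = w.2 i := rfl

theorem swapEquiv_inr (w : (Fin d → ℤ) × (Fin d → ℤ)) (i : Fin d) :
    swapEquiv d w (Sum.inr i) = w.1 i := rfl

/-- Expanding `(u + w₁)·(v + w₂)`, the cross terms pair `u` with `w₂` and `v` with `w₁`, hence the
swapped frequency; `w₁·w₂` is an integer and contributes nothing. -/
theorem pairCharacter_add_latticePoint (x : Fin d ⊕ Fin d → ℝ)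
    (w : (Fin d → ℤ) × (Fin d → ℤ)) :
    pairCharacter (pairEquiv d x + latticePoint w) =
      UnitAddTorus.mFourier (swapEquiv d w) (torusMk x) * pairCharacter (pairEquiv d x) := by
  have h := pairCharacter_latticePoint w
  rw [mFourier_torusMk]
  unfold pairCharacter at h ⊢
  -- The factor 1 is written as the phase at `w`, so that the exponents agree exactly, including the
  -- term `w₁·w₂`.
  rw [← mul_one (Complex.exp _ * Complex.exp _), ← h, ← Complex.exp_add, ← Complex.exp_add,
    ← mul_add, ← mul_add, ← Complex.ofReal_add, ← Complex.ofReal_add]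
  congr 4
  simp only [Prod.fst_add, Prod.snd_add, inner_add_left, inner_add_right]
  simp [pairEquiv_apply, latticePoint, PiLp.inner_apply, swapEquiv_inl, swapEquiv_inr,
    Fintype.sum_sum_type, mul_comm]
  ring

/-- Poisson summation for `φ` times the phase; this is the scalar form of the constant-integrand
case. -/
theorem hasSum_integral_latticePartition (φ : LatticePartition d) :
    HasSum (fun w => ∫ p, (φ.toFun (p - latticePoint w) : ℂ) * pairCharacter p) 1 := by
  let ψ : (Fin d ⊕ Fin d → ℝ) → ℂ := fun x =>
    (φ.toFun (pairEquiv d x) : ℂ) * pairCharacter (pairEquiv d x)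
  have hφ : ContDiff ℝ ∞ fun x => (φ.toFun (pairEquiv d x) : ℂ) :=
    Complex.ofRealCLM.contDiff.comp (φ.contDiff.comp (pairEquiv d).contDiff)
  have hs : ContDiff ℝ ∞ ψ := hφ.mul (contDiff_pairCharacter.comp (pairEquiv d).contDiff)
  have hψ : HasCompactSupport ψ :=
    HasCompactSupport.mul_right ((φ.hasCompactSupport.comp_homeomorph
      (pairEquiv d).toHomeomorph).comp_left Complex.ofReal_zero)
  have key := (swapEquiv d).hasSum_iff.2 (hasSum_integral_mFourier_mul hs hψ)
  convert key using 1
  · funext w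
    have : (volume : Measure (EuclideanSpace ℝ (Fin d) ×
        EuclideanSpace ℝ (Fin d))).IsAddHaarMeasure := Measure.prod.instIsAddHaarMeasure _ _
    -- Translation by `w` moves the dependence on `w` from the cutoff to the phase.
    rw [Function.comp_apply, ← integral_add_right_eq_self _ (latticePoint w),
      ← measurePreserving_pairEquiv.integral_comp
        (pairEquiv d).toHomeomorph.measurableEmbedding]
    refine integral_congr_ae (Eventually.of_forall fun x => ?_)
    simp only [add_sub_cancel_right, pairCharacter_add_latticePoint, ψ]
    ring
  · have h1 := φ.hasSum_translates 0
    have h2 := (Complex.hasSum_ofReal.2 h1).tsum_eq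
    rw [Complex.ofReal_one] at h2
    -- The partition of unity at the origin involves `φ(-w)`, whereas Poisson summation yields
    -- `φ(w)`; hence the sign change.
    rw [← h2, ← ((Equiv.neg _).trans
      (Equiv.sumArrowEquivProdArrow (Fin d) (Fin d) ℤ).symm).tsum_eq (fun w => ψ (intVec w))]
    refine tsum_congr fun w => ?_
    have h3 : pairEquiv d (intVec (((Equiv.neg _).trans
        (Equiv.sumArrowEquivProdArrow (Fin d) (Fin d) ℤ).symm) w)) = latticePoint (-w) := rfl
    have h4 : latticePoint (-w) = 0 - latticePoint w := by
      rw [zero_sub]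
      refine Prod.ext ?_ ?_ <;> ext i <;> simp [latticePoint]
    simp only [ψ, h3, pairCharacter_latticePoint, mul_one]
    rw [h4]

/-- The oscillatory integral of a constant is that constant. -/
theorem hasOscillatoryIntegral_const {A : Type*} [NormedAddCommGroup A] [NormedSpace ℂ A]
    [CompleteSpace A] (a : A) :
    HasOscillatoryIntegral
      (fun _ : EuclideanSpace ℝ (Fin d) × EuclideanSpace ℝ (Fin d) => a) a := by
  intro φ
  have h := (hasSum_integral_latticePartition φ).smul_const a
  rw [one_smul] at h
  refine h.congr_fun fun w => ?_
  exact integral_smul_const _ _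

end ConstantIntegrand

/-! ## Functions supported away from the fields -/

section Invariance

variable {n : ℕ} {N : Type*} [TopologicalSpace N] [ChartedSpace (EuclideanSpace ℝ (Fin n)) N]

/-- A constant curve at a zero of a vector field is an integral curve. -/
theorem isMIntegralCurve_const {X : (q : N) → TangentSpace (𝓡 n) q} {x : N} (h0 : X x = 0) :
    IsMIntegralCurve (fun _ : ℝ => x) X := fun t => by
  have := hasMFDerivAt_const (I := 𝓘(ℝ, ℝ)) (I' := 𝓡 n) x t
  have hz : (1 : ℝ →L[ℝ] ℝ).smulRight (X x : EuclideanSpace ℝ (Fin n)) = 0 := by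
    rw [show (X x : EuclideanSpace ℝ (Fin n)) = 0 from h0]
    exact ContinuousLinearMap.smulRight_zero _
  exact (congrArg (fun T : ℝ →L[ℝ] EuclideanSpace ℝ (Fin n) =>
    HasMFDerivAt 𝓘(ℝ, ℝ) (𝓡 n) (fun _ : ℝ => x) t T) hz).mpr this

variable [IsManifold (𝓡 n) ∞ N] [T2Space N]

/-- Zeros of a vector field are fixed by its flow. -/
theorem flow_eq_self {X : (q : N) → TangentSpace (𝓡 n) q} (hX : SmoothField X)
    {K : Set N} (hK : IsCompact K) (hXK : fieldSupport X ⊆ K) (t : ℝ) {x : N} (h0 : X x = 0) :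
    flow hX hK hXK t x = x :=
  -- Uniqueness of integral curves: the constant curve also starts at `x`.
  congrFun (isMIntegralCurve_Ioo_eq_of_contMDiff_boundaryless (t₀ := 0)
    (hX.of_le (by norm_num)) (isMIntegralCurve_flow hX hK hXK x) (isMIntegralCurve_const h0)
    (flow_zero hX hK hXK x)) t

/-! ### Triviality of the action away from `K`. -/

namespace CommutingFields

variable {d : ℕ} {K : TopologicalSpace.Compacts N} (𝒳 : CommutingFields n d K)

theorem flowMap_eq_self (i : Fin d) (t : ℝ) {x : N} (hx : x ∉ K) : 𝒳.flowMap i t x = x := by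
  refine flow_eq_self (𝒳.smooth i) K.isCompact (𝒳.support_subset i) t ?_
  by_contra h
  exact hx (𝒳.support_subset i (subset_closure h))

/-- A point of `K` carried outside would land at a fixed point; flowing back by `-t` would not move
it, so it would have been outside from the start. -/
theorem flowMap_mem (i : Fin d) (t : ℝ) {x : N} (hx : x ∈ K) : 𝒳.flowMap i t x ∈ K := by
  by_contra h
  have h1 : 𝒳.flowMap i (-t) (𝒳.flowMap i t x) = x := by
    have h2 := flow_add (𝒳.smooth i) K.isCompact (𝒳.support_subset i) (-t) t x
    rw [neg_add_cancel, flow_zero] at h2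
    exact h2.symm
  rw [𝒳.flowMap_eq_self i (-t) h] at h1
  exact h (h1.symm ▸ hx)

theorem jointFlow_eq_self_and_mem (v : EuclideanSpace ℝ (Fin d)) (x : N) :
    (x ∉ K → 𝒳.jointFlow v x = x) ∧ (x ∈ K → 𝒳.jointFlow v x ∈ K) := by
  unfold jointFlow
  have hl : ∀ φ ∈ List.ofFn fun i => 𝒳.flowMap i (v i),
      (∀ y ∉ K, φ y = y) ∧ ∀ y ∈ K, φ y ∈ K := by
    intro φ hφ
    obtain ⟨i, rfl⟩ := List.mem_ofFn.1 hφ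
    exact ⟨fun y hy => 𝒳.flowMap_eq_self i _ hy, fun y hy => 𝒳.flowMap_mem i _ hy⟩
  generalize List.ofFn (fun i => 𝒳.flowMap i (v i)) = l at hl ⊢
  induction l with
  | nil => exact ⟨fun _ => rfl, fun h => h⟩
  | cons φ l ih =>
    have h1 := hl φ List.mem_cons_self
    have h2 := ih fun ψ hψ => hl ψ (List.mem_cons_of_mem _ hψ)
    rw [List.foldr_cons, ContinuousMap.comp_apply]
    exact ⟨fun hx => by rw [h2.1 hx, h1.1 x hx], fun hx => h1.2 _ (h2.2 hx)⟩

/-- Functions supported away from `K` are invariant under the action. -/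
theorem action_eq_self {f : N →ᵇ ℂ} (hf : Disjoint (tsupport f) (K : Set N))
    (v : EuclideanSpace ℝ (Fin d)) : 𝒳.action v f = f := by
  ext x
  have h0 : ∀ y ∈ K, f y = 0 := fun y hy =>
    image_eq_zero_of_notMem_tsupport fun h => Set.disjoint_left.1 hf h hy
  obtain ⟨h1, h2⟩ := 𝒳.jointFlow_eq_self_and_mem v x
  change f (𝒳.jointFlow v x) = f x
  by_cases hx : x ∈ K
  · rw [h0 x hx, h0 _ (h2 hx)]
  · rw [h1 hx]

/-- On `K` both sides vanish with `f`; off `K` the flow does not move the argument of `g`. -/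
theorem mul_action_eq_mul {f : N →ᵇ ℂ} (hf : Disjoint (tsupport f) (K : Set N))
    (v : EuclideanSpace ℝ (Fin d)) (g : N →ᵇ ℂ) : f * 𝒳.action v g = f * g := by
  ext x
  change f x * g (𝒳.jointFlow v x) = f x * g x
  by_cases hx : x ∈ K
  · rw [image_eq_zero_of_notMem_tsupport fun h => Set.disjoint_left.1 hf h hx, zero_mul, zero_mul]
  · rw [(𝒳.jointFlow_eq_self_and_mem v x).1 hx]

variable (Θ : EuclideanSpace ℝ (Fin d) →ₗ[ℝ] EuclideanSpace ℝ (Fin d))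

theorem hasOscillatoryIntegral_left {f : N →ᵇ ℂ} (hf : Disjoint (tsupport f) (K : Set N))
    (g : N →ᵇ ℂ) : HasOscillatoryIntegral (𝒳.productIntegrand Θ f g) (f * g) := by
  have h : 𝒳.productIntegrand Θ f g = fun _ => f * g := funext fun p => by
    rw [productIntegrand, 𝒳.action_eq_self hf, 𝒳.mul_action_eq_mul hf]
  rw [h]
  exact hasOscillatoryIntegral_const _

theorem hasOscillatoryIntegral_right {f : N →ᵇ ℂ} (hf : Disjoint (tsupport f) (K : Set N))
    (g : N →ᵇ ℂ) : HasOscillatoryIntegral (𝒳.productIntegrand Θ g f) (f * g) := by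
  have h : 𝒳.productIntegrand Θ g f = fun _ => f * g := funext fun p => by
    rw [productIntegrand, 𝒳.action_eq_self hf, mul_comm, 𝒳.mul_action_eq_mul hf]
  rw [h]
  exact hasOscillatoryIntegral_const _

/-- Smooth vectors are closed under the pointwise product. -/
theorem mul_mem_smoothVectors {f g : N →ᵇ ℂ} (hf : f ∈ 𝒳.smoothVectors)
    (hg : g ∈ 𝒳.smoothVectors) : f * g ∈ 𝒳.smoothVectors :=
  -- Each `α_v` is multiplicative, so the orbit map of `f * g` is the product of two smooth maps
  -- into a Banach algebra.
  ContDiff.mul (𝕜 := ℝ) (n := ∞) (f := fun v => 𝒳.action v f) (g := fun v => 𝒳.action v g) hf hg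

/-- Smooth vectors are closed under complex conjugation. -/
theorem star_mem_smoothVectors {f : N →ᵇ ℂ} (hf : f ∈ 𝒳.smoothVectors) :
    star f ∈ 𝒳.smoothVectors :=
  -- Conjugation commutes with `α_v` and is continuous and real-linear, hence smooth over `ℝ`.
  (starL' ℝ (A := N →ᵇ ℂ)).contDiff.comp (n := ∞) (f := fun v => 𝒳.action v f) hf

end CommutingFields

end Invariance

end RieffelDeformation

theorem mainTheorem9 {n d : ℕ} {N : Type*} [TopologicalSpace N] [T2Space N]
    [ChartedSpace (EuclideanSpace ℝ (Fin n)) N] [IsManifold (𝓡 n) ∞ N]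
    (K : TopologicalSpace.Compacts N)
    (𝒳 : RieffelDeformation.CommutingFields n d K)
    (Θ : EuclideanSpace ℝ (Fin d) →ₗ[ℝ] EuclideanSpace ℝ (Fin d))
    (hΘ : ∀ u v, inner ℝ (Θ u) v = - inner ℝ u (Θ v)) :
    (∀ f ∈ 𝒳.smoothVectors, Disjoint (tsupport f) (K : Set N) → ∀ g ∈ 𝒳.smoothVectors,
      RieffelDeformation.HasOscillatoryIntegral (𝒳.productIntegrand Θ f g) (f * g) ∧
      RieffelDeformation.HasOscillatoryIntegral (𝒳.productIntegrand Θ g f) (f * g) ∧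
      𝒳.deformedProduct Θ f g = f * g ∧
      𝒳.deformedProduct Θ g f = f * g ∧
      Disjoint (tsupport (𝒳.deformedProduct Θ f g)) (K : Set N) ∧
      Disjoint (tsupport (𝒳.deformedProduct Θ g f)) (K : Set N)) ∧
    RieffelDeformation.IsCentralStarIdeal 𝒳.smoothVectors (𝒳.deformedProduct Θ)
      {f | f ∈ 𝒳.smoothVectors ∧ Disjoint (tsupport f) (K : Set N)} := by
  have hl : ∀ {f g : N →ᵇ ℂ}, Disjoint (tsupport f) (K : Set N) →
      𝒳.deformedProduct Θ f g = f * g := fun hf =>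
    (𝒳.hasOscillatoryIntegral_left Θ hf _).eq
  have hr : ∀ {f g : N →ᵇ ℂ}, Disjoint (tsupport f) (K : Set N) →
      𝒳.deformedProduct Θ g f = f * g := fun hf =>
    (𝒳.hasOscillatoryIntegral_right Θ hf _).eq
  have hd : ∀ {f g : N →ᵇ ℂ}, Disjoint (tsupport f) (K : Set N) →
      Disjoint (tsupport (f * g : N →ᵇ ℂ)) (K : Set N) := fun hf =>
    hf.mono_left (tsupport_mul_subset_left (f := (_ : N → ℂ)))
  refine ⟨fun f _ hf g _ => ⟨𝒳.hasOscillatoryIntegral_left Θ hf g,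
    𝒳.hasOscillatoryIntegral_right Θ hf g, hl hf, hr hf, ?_, ?_⟩, ?_⟩
  · rw [hl hf]
    exact hd hf
  · rw [hr hf]
    exact hd hf
  · exact
      { subset := fun f hf => hf.1
        zero_mem := ⟨zero_mem _, by simp [tsupport]⟩
        add_mem := fun f hf g hg => ⟨add_mem hf.1 hg.1,
          (hf.2.sup_left hg.2).mono_left (tsupport_add (f : N → ℂ) g)⟩
        smul_mem := fun c f hf => ⟨Submodule.smul_mem _ c hf.1,
          hf.2.mono_left (closure_mono (Function.support_const_smul_subset c (f : N → ℂ)))⟩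
        star_mem := fun f hf => ⟨𝒳.star_mem_smoothVectors hf.1,
          hf.2.mono_left (closure_mono (Function.support_comp_subset (star_zero ℂ) f))⟩
        mul_mem_left := fun g hg f hf => by
          rw [hr hf.2]
          exact ⟨𝒳.mul_mem_smoothVectors hf.1 hg, hd hf.2⟩
        mul_mem_right := fun f hf g hg => by
          rw [hl hf.2]
          exact ⟨𝒳.mul_mem_smoothVectors hf.1 hg, hd hf.2⟩
        central := fun f hf g _ => by rw [hl hf.2, hr hf.2] }
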